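/- Let $\mathbb F$ be an algebraically closed field, let $e_1<e_2<\dots<e_k$ be integers, let $n$ be a non-negative integer, and for $\alpha=(\alpha_1,\dots,\alpha_n)\in\mathbb F^n$ let $V=V(\alpha)$ be the $k\times n$ matrix over $\mathbb F$ with entries $V_{i,j}=\alpha_j^{e_i}$. Notation. For a matrix $G$ and a set $A$ of column indices, $G_A$ is the span of the columns of $G$ with index in $A$; for a matrix $U$ and an integer $\sigma\ge 0$, $U_{\le\sigma}$ is the span of the first $\sigma$ columns of $U$. A generic matrix over $\mathbb F$ is a matrix whose entries are algebraically independent transcendentals over $\mathbb F$, in the field of rational functions in these variables. A $k\times n$ matrix $G$ over $\mathbb F$ is $\operatorname{MDS}(\ell)$ if for all $A_1,\dots,A_\ell\subseteq\{1,\dots,n\}$ $$\dim\Big(\bigcap_{i=1}^{\ell}G_{A_i}\Big)=\dim\Big(\bigcap_{i=1}^{\ell}W_{A_i}\Big),$$ where $W$ is a generic $k\times n$ matrix over $\mathbb F$. A pair $(U,V)$ with $U\in\mathbb F^{k\times b}$ and $V\in\mathbb F^{k\times n}$ is a higher order MDS code with a basis of order $\ell$, $\operatorname{MDSb}(\ell)$,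 if for all $\sigma_1,\dots,\sigma_\ell\in\{0,1,\dots,b\}$ and $A_1,\dots,A_\ell\subseteq\{1,\dots,n\}$ $$\dim\Big(\bigcap_{i=1}^{\ell}\big(U_{\le\sigma_i}+V_{A_i}\big)\Big)=\dim\Big(\bigcap_{i=1}^{\ell}\big(W_{\le\sigma_i}+W'_{A_i}\big)\Big),$$ where $[W\mid W']$ is a generic $k\times(b+n)$ matrix over $\mathbb F$, split into its first $b$ and its last $n$ columns. Theorem. If $\alpha_1,\dots,\alpha_n$ are generic, then the matrix $V(\alpha)$ is $\operatorname{MDS}(\ell)$ for all $\ell\ge 2$, and moreover the pair $(I_k,V(\alpha))$ is $\operatorname{MDSb}(\ell)$ for all $\ell\ge 1$. Here "generic" may be understood in either of the following two senses: (1) there is a nonzero polynomial $P\in\mathbb F[x_1,\dots,x_n]$ (depending on $e_1,\dots,e_k$ and $n$, but not on $\ell$) such that the conclusion holds, for all these $\ell$ at once, for every $\alpha\in\mathbb F^n$ with $P(\alpha)\ne 0$; (2) the conclusion holds for all $\alpha_1,\dots,\alpha_n\in\mathbb F$ that are algebraically independent over some field $K$ of which $\mathbb F$ is an extension. -/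

import Mathlib

universe u v

/-- The span `G_A` of the columns of the matrix `G` with index in `A`. -/
def colSpan {F ι κ : Type*} [Field F] (G : Matrix ι κ F) (A : Set κ) : Submodule F (ι → F) :=
  Submodule.span F ((fun j => fun i => G i j) '' A)

/-- The span `U_{≤ σ}` of the first `σ` columns of the matrix `U`. -/
def prefixSpan {F ι : Type*} [Field F] {b : ℕ} (U : Matrix ι (Fin b) F) (σ : ℕ) :
    Submodule F (ι → F) :=
  colSpan U {j | (j : ℕ) < σ}

/-- The field obtained from `F` by adjoining one independent transcendental for each position
of an `ι × κ` matrix: the rational functions in the variables `w_{i,j}`. -/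
abbrev GenericField (F ι κ : Type*) [Field F] : Type _ :=
  FractionRing (MvPolynomial (ι × κ) F)

/-- The generic `ι × κ` matrix over `F`: its `(i, j)` entry is the variable `w_{i,j}`. -/
noncomputable def genericMatrix (F ι κ : Type*) [Field F] : Matrix ι κ (GenericField F ι κ) :=
  fun i j => algebraMap (MvPolynomial (ι × κ) F) (GenericField F ι κ) (MvPolynomial.X (i, j))

/-- The `k × n` matrix `G` is `MDS(ℓ)`: for all `A_1, …, A_ℓ ⊆ [n]`, the intersection of the
`G_{A_i}` has the same dimension as for a generic `k × n` matrix. -/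
def IsMDS {F : Type*} [Field F] {k n : ℕ} (ℓ : ℕ) (G : Matrix (Fin k) (Fin n) F) : Prop :=
  ∀ A : Fin ℓ → Set (Fin n),
    Module.finrank F (⨅ i, colSpan G (A i) : Submodule F (Fin k → F)) =
      Module.finrank (GenericField F (Fin k) (Fin n))
        (⨅ i, colSpan (genericMatrix F (Fin k) (Fin n)) (A i) :
          Submodule (GenericField F (Fin k) (Fin n)) (Fin k → GenericField F (Fin k) (Fin n)))

/-- The first block `W` of the generic `k × (b + n)` matrix `[W | W']`. -/
noncomputable def genericBasis (F : Type*) [Field F] (k b n : ℕ) :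
    Matrix (Fin k) (Fin b) (GenericField F (Fin k) (Fin b ⊕ Fin n)) :=
  fun i j => genericMatrix F (Fin k) (Fin b ⊕ Fin n) i (Sum.inl j)

/-- The second block `W'` of the generic `k × (b + n)` matrix `[W | W']`. -/
noncomputable def genericCode (F : Type*) [Field F] (k b n : ℕ) :
    Matrix (Fin k) (Fin n) (GenericField F (Fin k) (Fin b ⊕ Fin n)) :=
  fun i j => genericMatrix F (Fin k) (Fin b ⊕ Fin n) i (Sum.inr j)

/-- `(U, V)` is an order-`ℓ` higher order MDS code with a basis, `(b, n, k)`-`MDSb(ℓ)`: for all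
`σ_1, …, σ_ℓ ∈ {0, …, b}` and `A_1, …, A_ℓ ⊆ [n]`, the intersection of the spaces
`U_{≤ σ_i} + V_{A_i}` has the same dimension as for a pair `(W, W')` of generic matrices whose
entries are algebraically independent of each other. -/
def IsMDSb {F : Type*} [Field F] {k b n : ℕ} (ℓ : ℕ)
    (U : Matrix (Fin k) (Fin b) F) (V : Matrix (Fin k) (Fin n) F) : Prop :=
  ∀ (σ : Fin ℓ → ℕ) (A : Fin ℓ → Set (Fin n)), (∀ i, σ i ≤ b) →
    Module.finrank F
        (⨅ i, (prefixSpan U (σ i) ⊔ colSpan V (A i)) : Submodule F (Fin k → F)) =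
      Module.finrank (GenericField F (Fin k) (Fin b ⊕ Fin n))
        (⨅ i, (prefixSpan (genericBasis F k b n) (σ i) ⊔ colSpan (genericCode F k b n) (A i)) :
          Submodule (GenericField F (Fin k) (Fin b ⊕ Fin n))
            (Fin k → GenericField F (Fin k) (Fin b ⊕ Fin n)))

/-- The `k × n` monomial code matrix with `(i, j)` entry `α_j ^ e_i`. -/
def monomialMatrix {F : Type*} [Field F] {k n : ℕ} (e : Fin k → ℤ) (α : Fin n → F) :
    Matrix (Fin k) (Fin n) F :=
  fun i j => α j ^ e i

/-!
The dimension of an intersection of column spaces is controlled by the sum of their annihilators.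
For the matrix `[1 | V]` the annihilator of `U_{≤ s} + V_A` consists of the polynomials
`∑ p_m x ^ e_m` whose first `s` coefficients vanish and which vanish at the points `α_j`, `j ∈ A`.

The heart of the matter is a statement in the style of the GM-MDS theorem
(`disjointSolutions_of_card_le`): for independent variables as points, such spaces of polynomials
are linearly disjoint whenever, for every subfamily, the sum of the expected dimensions does not
exceed the dimension of the space attached to the common part of the index sets. If a proper
subfamily attains equality, it is merged into one member. If at most one member of the family
contains polynomials with a nonzero lowest coefficient, that coefficient vanishes in every relation
and can be dropped. Otherwise some variable can be sent to zero (`DisjointSolutions.of_killVar`).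
A polynomial that vanishes at this variable then loses its lowest coefficient instead, and so the
initial basis vectors enter the induction; this is why the statement about codes with a basis is
the natural one to prove.

Any matrix with independent columns in the relevant sets yields numbers `δ i` for which the
condition above holds: choose a basis of the sum of the annihilators inside their union and count.
Fresh points cut the spaces of polynomials down to dimension `δ i`, and disjointness then shows that
the sum of the annihilators for `[1 | V]` is at least as large as for the given matrix. A matrix
with this property is called extremal (`IsExtremal`); two extremal matrices over any fields have
intersections of the same dimension (`IsExtremal.finrank_iInf_eq`). Extremality is an open condition
(`exists_forall_isExtremal`), so it passes from `[1 | V]` in independent variables to the generic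
matrices, which specialize to it, and to `[1 | V(α)]` for all `α` off a hypersurface. The number of
spaces does not matter because only the finite set of index sets does.
-/

/-! ### Spaces of polynomials with prescribed zeros -/

/-- `p` is the coefficient vector of a combination `∑ m, p m * x ^ e m` in which the first `s`
coefficients vanish and which has the points `β j`, `j ∈ A`, among its zeros. -/
def Vanishes {R κ : Type*} [CommRing R] {k : ℕ} (e : Fin k → ℕ) (β : κ → R) (s : ℕ)
    (A : Finset κ) (p : Fin k → R) : Prop :=
  (∀ m : Fin k, (m : ℕ) < s → p m = 0) ∧ ∀ j ∈ A, ∑ m, p m * β j ^ e m = 0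

/-- The modules of solutions of `Vanishes e β (σ i) (A i)`, `i ∈ T`, are linearly disjoint: a
family of solutions with sum zero is zero. -/
def DisjointSolutions {R κ ι : Type*} [CommRing R] {k : ℕ} (e : Fin k → ℕ) (β : κ → R)
    (T : Finset ι) (σ : ι → ℕ) (A : ι → Finset κ) : Prop :=
  ∀ p : ι → Fin k → R, (∀ i ∈ T, Vanishes e β (σ i) (A i) (p i)) → ∑ i ∈ T, p i = 0 →
    ∀ i ∈ T, p i = 0

theorem Vanishes.mono {R κ : Type*} [CommRing R] {k : ℕ} {e : Fin k → ℕ} {β : κ → R} {s c : ℕ}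
    {A B : Finset κ} {p : Fin k → R} (h : Vanishes e β s A p) (hc : c ≤ s) (hB : B ⊆ A) :
    Vanishes e β c B p :=
  ⟨fun m hm => h.1 m (hm.trans_le hc), fun j hj => h.2 j (hB hj)⟩

theorem Vanishes.sum {R κ ι : Type*} [CommRing R] {k : ℕ} {e : Fin k → ℕ} {β : κ → R} {s : ℕ}
    {A : Finset κ} {p : ι → Fin k → R} {I : Finset ι} (h : ∀ i ∈ I, Vanishes e β s A (p i)) :
    Vanishes e β s A (∑ i ∈ I, p i) := by
  refine ⟨fun m hm => ?_, fun j hj => ?_⟩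
  · rw [Finset.sum_apply]
    exact Finset.sum_eq_zero fun i hi => (h i hi).1 m hm
  · simp only [Finset.sum_apply, Finset.sum_mul]
    rw [Finset.sum_comm]
    exact Finset.sum_eq_zero fun i hi => (h i hi).2 j hj

/-! ### Degeneration of a variable to zero -/

open Classical in
/-- Setting the variable `X j` to zero. -/
noncomputable def killVar {K κ : Type*} [Field K] (j : κ) :
    MvPolynomial κ K →ₐ[K] MvPolynomial κ K :=
  MvPolynomial.aeval fun i => if i = j then 0 else MvPolynomial.X i

theorem killVar_X_self {K κ : Type*} [Field K] (j : κ) :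
    killVar j (MvPolynomial.X j : MvPolynomial κ K) = 0 := by
  simp [killVar]

theorem killVar_X_of_ne {K κ : Type*} [Field K] {i j : κ} (h : i ≠ j) :
    killVar j (MvPolynomial.X i : MvPolynomial κ K) = MvPolynomial.X i := by
  simp [killVar, h]

theorem X_dvd_of_killVar_eq_zero {K κ : Type*} [Field K] (j : κ) (q : MvPolynomial κ K)
    (h : killVar j q = 0) : MvPolynomial.X j ∣ q := by
  have key : (Ideal.Quotient.mkₐ K (Ideal.span {(MvPolynomial.X j : MvPolynomial κ K)})).comp
      (killVar j) = Ideal.Quotient.mkₐ K (Ideal.span {(MvPolynomial.X j : MvPolynomial κ K)}) := by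
    apply MvPolynomial.algHom_ext
    intro i
    by_cases hi : i = j
    · subst hi
      rw [AlgHom.comp_apply, killVar_X_self, map_zero]
      symm
      exact Ideal.Quotient.eq_zero_iff_mem.2 (Ideal.mem_span_singleton_self _)
    · rw [AlgHom.comp_apply, killVar_X_of_ne hi]
  have h2 := DFunLike.congr_fun key q
  rw [AlgHom.comp_apply, h, map_zero] at h2
  exact Ideal.mem_span_singleton.1 (Ideal.Quotient.eq_zero_iff_mem.1 h2.symm)

open Classical in
/-- If `∑ p_m x ^ e_m` vanishes at `X j` and starts at `x ^ e_s`, then dividing by `X j ^ e_s` and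
setting `X j = 0` shows that the coefficient `p_s` is zero at `X j = 0`. -/
theorem Vanishes.map_killVar {K κ : Type*} [Field K] {k : ℕ} {e : Fin k → ℕ} (he : StrictMono e)
    (j : κ) {s : ℕ} {A : Finset κ} {p : Fin k → MvPolynomial κ K}
    (h : Vanishes e MvPolynomial.X s A p) :
    Vanishes e MvPolynomial.X (s + if j ∈ A then 1 else 0) (A.erase j)
      (fun m => killVar j (p m)) := by
  refine ⟨fun m hm => ?_, fun i hi => ?_⟩
  · change killVar j (p m) = 0
    by_cases hms : (m : ℕ) < s
    · rw [h.1 m hms, map_zero]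
    · have hj : j ∈ A := by
        by_contra hj
        simp [hj] at hm
        omega
      have hms : (m : ℕ) = s := by
        simp [hj] at hm
        omega
      have h2 : (MvPolynomial.X j : MvPolynomial κ K) ^ e m *
          ∑ l, p l * MvPolynomial.X j ^ (e l - e m) = 0 := by
        rw [← h.2 j hj, Finset.mul_sum]
        refine Finset.sum_congr rfl fun l _ => ?_
        by_cases hl : (l : ℕ) < s
        · simp [h.1 l hl]
        · have : e m ≤ e l := he.monotone (Fin.le_def.2 (by omega))
          rw [mul_left_comm, ← pow_add, Nat.add_sub_cancel' this]
      have h3 := (mul_eq_zero.1 h2).resolve_left (pow_ne_zero _ (MvPolynomial.X_ne_zero j))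
      have h4 := congrArg (killVar j) h3
      rw [map_sum, map_zero, Finset.sum_eq_single m] at h4
      · simpa using h4
      · intro l _ hl
        by_cases hl' : (l : ℕ) < s
        · simp [h.1 l hl']
        · have hlt : e m < e l := he (lt_of_le_of_ne (Fin.le_def.2 (by omega)) (Ne.symm hl))
          rw [map_mul, map_pow, killVar_X_self, zero_pow (by omega), mul_zero]
      · simp
  · have hne := Finset.ne_of_mem_erase hi
    have h2 := congrArg (killVar j) (h.2 i (Finset.mem_of_mem_erase hi))
    simpa [map_sum, map_mul, map_pow, killVar_X_of_ne hne] using h2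

open Classical in
/-- Degeneration `X j → 0`: vanishing at `X j` becomes the loss of one more initial coefficient.
A relation between solutions can be divided by powers of `X j` until it survives `X j = 0`. -/
theorem DisjointSolutions.of_killVar {K κ ι : Type*} [Field K] {k : ℕ} {e : Fin k → ℕ}
    (he : StrictMono e) (j : κ) {T : Finset ι} {σ : ι → ℕ} {A : ι → Finset κ}
    (h : DisjointSolutions e (MvPolynomial.X : κ → MvPolynomial κ K) T
      (fun i => σ i + if j ∈ A i then 1 else 0) (fun i => (A i).erase j)) :
    DisjointSolutions e (MvPolynomial.X : κ → MvPolynomial κ K) T σ A := by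
  intro p hp hsum
  have hX : (MvPolynomial.X j : MvPolynomial κ K) ≠ 0 := MvPolynomial.X_ne_zero j
  have key : ∀ N : ℕ, ∃ q : ι → Fin k → MvPolynomial κ K,
      ∀ i ∈ T, ∀ m, p i m = MvPolynomial.X j ^ N * q i m := by
    intro N
    induction N with
    | zero => exact ⟨p, by simp⟩
    | succ N ih =>
      obtain ⟨q, hq⟩ := ih
      have hN := pow_ne_zero N hX
      have hqv : ∀ i ∈ T, Vanishes e MvPolynomial.X (σ i) (A i) (q i) := by
        intro i hi
        refine ⟨fun m hm => ?_, fun l hl => ?_⟩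
        · have := (hp i hi).1 m hm
          rw [hq i hi m] at this
          exact (mul_eq_zero.1 this).resolve_left hN
        · have := (hp i hi).2 l hl
          simp only [hq i hi, mul_assoc, ← Finset.mul_sum] at this
          exact (mul_eq_zero.1 this).resolve_left hN
      have hqs : ∀ m, ∑ i ∈ T, q i m = 0 := by
        intro m
        have := congrFun hsum m
        rw [Finset.sum_apply, Finset.sum_congr rfl (fun i hi => hq i hi m), ← Finset.mul_sum]
          at this
        exact (mul_eq_zero.1 this).resolve_left hN
      have h0 := h (fun i m => killVar j (q i m)) (fun i hi => (hqv i hi).map_killVar he j) (by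
        ext1 m
        rw [Finset.sum_apply, ← map_sum, hqs, map_zero, Pi.zero_apply])
      have hd : ∀ i, ∀ m, ∃ r, i ∈ T → q i m = MvPolynomial.X j * r := by
        intro i m
        by_cases hi : i ∈ T
        · obtain ⟨r, hr⟩ := X_dvd_of_killVar_eq_zero j (q i m) (congrFun (h0 i hi) m)
          exact ⟨r, fun _ => hr⟩
        · exact ⟨0, fun h => (hi h).elim⟩
      choose r hr using hd
      refine ⟨r, fun i hi m => ?_⟩
      rw [hq i hi m, hr i m hi, pow_succ, mul_assoc]
  intro i hi
  ext1 m
  by_contra hne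
  obtain ⟨q, hq⟩ := key ((p i m).totalDegree + 1)
  have hqm := hq i hi m
  have hq0 : q i m ≠ 0 := by
    intro h0
    rw [h0, mul_zero] at hqm
    exact hne hqm
  have := congrArg MvPolynomial.totalDegree hqm
  rw [MvPolynomial.totalDegree_mul_of_isDomain (pow_ne_zero _ hX) hq0,
    MvPolynomial.totalDegree_X_pow] at this
  omega

open Classical in
/-- Generalized Vandermonde matrices in independent variables are nonsingular: if `k ≤ s + |A|`, the
solutions of `Vanishes e X s A` are zero. This is expressed as their disjointness from the space
of all coefficient vectors, which brings it within reach of degeneration. -/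
theorem disjointSolutions_bool {K κ : Type*} [Field K] {k : ℕ} {e : Fin k → ℕ}
    (he : StrictMono e) {s : ℕ} {A : Finset κ} (hk : k ≤ s + A.card) :
    DisjointSolutions e (MvPolynomial.X : κ → MvPolynomial κ K) Finset.univ
      (fun b : Bool => if b then s else 0) (fun b => if b then A else ∅) := by
  induction hN : A.card generalizing s A with
  | zero =>
    intro q hq hsum
    have h1 : q true = 0 := by
      ext1 m
      exact (hq true (Finset.mem_univ _)).1 m (by simp; omega)
    have h2 : q false = 0 := by simpa [h1] using hsum
    intro b _
    cases b <;> assumption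
  | succ N ih =>
    obtain ⟨j, hj⟩ : A.Nonempty := Finset.card_pos.1 (by omega)
    apply DisjointSolutions.of_killVar he j
    have hc := Finset.card_erase_of_mem hj
    convert ih (s := s + 1) (A := A.erase j) (by omega) (by omega) using 2 with b b
    · cases b <;> simp [hj]
    · cases b <;> simp

theorem DisjointSolutions.eq_zero_of_vanishes {R κ : Type*} [CommRing R] {k : ℕ} {e : Fin k → ℕ}
    {β : κ → R} {s : ℕ} {A : Finset κ}
    (h : DisjointSolutions e β Finset.univ
      (fun b : Bool => if b then s else 0) (fun b => if b then A else ∅))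
    {p : Fin k → R} (hp : Vanishes e β s A p) : p = 0 := by
  have := h (fun b => if b then p else -p) (by
    intro b _
    cases b
    · exact ⟨by simp, by simp⟩
    · simpa using hp) (by simp) true (Finset.mem_univ _)
  simpa using this

/-! ### Disjointness in generic position -/

open Classical in
/-- In generic position the expected condition for disjointness is sufficient. The number
`d i` is the dimension of the `i`-th solution space, and the inequality for `I`, `c`, `B` says that
the solution space of `c`, `B`, which contains those with `i ∈ I`, has room for their direct sum. -/
theorem disjointSolutions_of_card_le {K κ ι : Type*} [Field K] {k : ℕ} {e : Fin k → ℕ}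
    (he : StrictMono e) (T : Finset ι) (σ : ι → ℕ) (A : ι → Finset κ) (d : ι → ℕ)
    (hd : ∀ i ∈ T, σ i + (A i).card + d i = k)
    (hT : ∀ I ⊆ T, I.Nonempty → ∀ (c : ℕ) (B : Finset κ), (∀ i ∈ I, c ≤ σ i ∧ B ⊆ A i) →
      ∑ i ∈ I, d i + c + B.card ≤ k) :
    DisjointSolutions e (MvPolynomial.X : κ → MvPolynomial κ K) T σ A := by
  obtain ⟨N, hN⟩ : ∃ N, k + T.card + ∑ i ∈ T, (A i).card = N := ⟨_, rfl⟩
  induction N using Nat.strong_induction_on generalizing k T σ A d with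
  | _ N ih =>
  subst hN
  rcases T.eq_empty_or_nonempty with rfl | hTne
  · intro p _ _ i hi
    simp at hi
  by_cases hd0 : ∃ i ∈ T, d i = 0
  · -- A solution space of dimension zero can be dropped.
    obtain ⟨i₀, hi₀, hdi⟩ := hd0
    have hlt : (T.erase i₀).card < T.card := Finset.card_erase_lt_of_mem hi₀
    have hle : ∑ i ∈ T.erase i₀, (A i).card ≤ ∑ i ∈ T, (A i).card :=
      Finset.sum_le_sum_of_subset (Finset.erase_subset _ _)
    have h1 := ih _ (by omega) he (T.erase i₀) σ A d
      (fun i hi => hd i (Finset.mem_of_mem_erase hi))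
      (fun I hI => hT I (hI.trans (Finset.erase_subset _ _))) rfl
    intro p hp hsum
    have hp0 : p i₀ = 0 := (disjointSolutions_bool he (by
      have := hd i₀ hi₀
      omega)).eq_zero_of_vanishes (hp i₀ hi₀)
    rw [← Finset.add_sum_erase _ _ hi₀, hp0, zero_add] at hsum
    have h2 := h1 p (fun i hi => hp i (Finset.mem_of_mem_erase hi)) hsum
    intro i hi
    by_cases h : i = i₀
    · rw [h, hp0]
    · exact h2 i (Finset.mem_erase.2 ⟨h, hi⟩)
  have hdpos : ∀ i ∈ T, 1 ≤ d i := fun i hi => by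
    by_contra h
    exact hd0 ⟨i, hi, by omega⟩
  by_cases htight : ∃ I ⊆ T, I ≠ T ∧ 2 ≤ I.card ∧ ∃ (c : ℕ) (B : Finset κ),
      (∀ i ∈ I, c ≤ σ i ∧ B ⊆ A i) ∧ ∑ i ∈ I, d i + c + B.card = k
  · -- The solution spaces with index in `I` fill that of `c`, `B`, which may replace them.
    obtain ⟨I, hIT, hne, hI2, c, B, hcB, heq⟩ := htight
    obtain ⟨i₀, hi₀⟩ : I.Nonempty := Finset.card_pos.1 (by omega)
    have hcard : I.card < T.card := Finset.card_lt_card (lt_of_le_of_ne hIT hne)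
    have hle : ∑ i ∈ I, (A i).card ≤ ∑ i ∈ T, (A i).card := Finset.sum_le_sum_of_subset hIT
    have hI := ih _ (by omega) he I σ A d (fun i hi => hd i (hIT hi))
      (fun J hJ => hT J (hJ.trans hIT)) rfl
    have hni : i₀ ∉ T \ I := by simp [hi₀]
    have hcard' : (insert i₀ (T \ I)).card = T.card - I.card + 1 := by
      rw [Finset.card_insert_of_notMem hni, Finset.card_sdiff_of_subset hIT]
    have hnei : ∀ i ∈ T \ I, i ≠ i₀ := fun i hi h => hni (h ▸ hi)
    have hsumA : ∑ i ∈ insert i₀ (T \ I), (Function.update A i₀ B i).card ≤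
        ∑ i ∈ T, (A i).card := by
      rw [Finset.sum_insert hni, Function.update_self, ← Finset.sum_sdiff hIT, add_comm]
      refine add_le_add (Finset.sum_le_sum fun i hi => ?_) ?_
      · rw [Function.update_of_ne (hnei i hi)]
      · exact (Finset.card_le_card (hcB i₀ hi₀).2).trans
          (Finset.single_le_sum (f := fun i => (A i).card) (fun _ _ => Nat.zero_le _) hi₀)
    have hM := ih _ (by omega) he (insert i₀ (T \ I)) (Function.update σ i₀ c)
      (Function.update A i₀ B) (Function.update d i₀ (∑ i ∈ I, d i)) (by
        intro i hi
        rcases Finset.mem_insert.1 hi with rfl | hi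
        · simp only [Function.update_self]
          omega
        · have hii := hnei i hi
          simp only [Function.update_of_ne hii]
          exact hd i (Finset.mem_sdiff.1 hi).1) (by
        intro J hJ hJne c' B' hcB'
        by_cases hJ0 : i₀ ∈ J
        · have hJ1 : J.erase i₀ ⊆ T \ I := fun i hi =>
            (Finset.mem_insert.1 (hJ (Finset.mem_of_mem_erase hi))).resolve_left
              (Finset.ne_of_mem_erase hi)
          have hdisj : Disjoint (J.erase i₀) I :=
            Finset.disjoint_of_subset_left hJ1 Finset.sdiff_disjoint
          have := hT (J.erase i₀ ∪ I) (Finset.union_subset (hJ1.trans Finset.sdiff_subset) hIT)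
            ⟨i₀, Finset.mem_union_right _ hi₀⟩ c' B' (by
              intro i hi
              rcases Finset.mem_union.1 hi with hi | hi
              · have h3 := hcB' i (Finset.mem_of_mem_erase hi)
                simpa only [Function.update_of_ne (Finset.ne_of_mem_erase hi)] using h3
              · have h3 := hcB' i₀ hJ0
                simp only [Function.update_self] at h3
                exact ⟨h3.1.trans (hcB i hi).1, h3.2.trans (hcB i hi).2⟩)
          rw [Finset.sum_union hdisj] at this
          rw [← Finset.sum_erase_add _ _ hJ0, Function.update_self,
            Finset.sum_congr rfl fun i hi =>
              Function.update_of_ne (Finset.ne_of_mem_erase hi) _ _]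
          exact this
        · have hJ1 : J ⊆ T \ I := fun i hi =>
            (Finset.mem_insert.1 (hJ hi)).resolve_left fun h => hJ0 (h ▸ hi)
          have hJ2 : ∀ i ∈ J, i ≠ i₀ := fun i hi h => hJ0 (h ▸ hi)
          have := hT J (hJ1.trans Finset.sdiff_subset) hJne c' B' (by
            intro i hi
            simpa only [Function.update_of_ne (hJ2 i hi)] using hcB' i hi)
          rwa [Finset.sum_congr rfl fun i hi => Function.update_of_ne (hJ2 i hi) _ _]) rfl
    intro p hp hsum
    have h1 := hM (Function.update p i₀ (∑ i ∈ I, p i)) (by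
      intro i hi
      rcases Finset.mem_insert.1 hi with rfl | hi
      · simp only [Function.update_self]
        exact Vanishes.sum fun i hi => (hp i (hIT hi)).mono (hcB i hi).1 (hcB i hi).2
      · have hii := hnei i hi
        simp only [Function.update_of_ne hii]
        exact hp i (Finset.mem_sdiff.1 hi).1) (by
      rw [Finset.sum_insert hni, Function.update_self, Finset.sum_congr rfl (fun i hi =>
        Function.update_of_ne (hnei i hi) _ _), add_comm, Finset.sum_sdiff hIT, hsum])
    have h2 : ∑ i ∈ I, p i = 0 := by
      simpa using h1 i₀ (Finset.mem_insert_self _ _)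
    intro i hi
    by_cases hiI : i ∈ I
    · exact hI p (fun i hi => hp i (hIT hi)) h2 i hiI
    · have := h1 i (Finset.mem_insert_of_mem (Finset.mem_sdiff.2 ⟨hi, hiI⟩))
      have hii : i ≠ i₀ := by
        rintro rfl
        exact hiI hi₀
      rwa [Function.update_of_ne hii] at this
  have hloose : ∀ I ⊆ T, I ≠ T → 2 ≤ I.card → ∀ (c : ℕ) (B : Finset κ),
      (∀ i ∈ I, c ≤ σ i ∧ B ⊆ A i) → ∑ i ∈ I, d i + c + B.card < k := by
    intro I hI hne h2 c B hcB
    refine lt_of_le_of_ne (hT I hI (Finset.card_pos.1 (by omega)) c B hcB) fun h => ?_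
    exact htight ⟨I, hI, hne, h2, c, B, hcB, h⟩
  by_cases htwo : ∃ i₀ ∈ T, ∃ i₁ ∈ T, i₀ ≠ i₁ ∧ σ i₀ = 0 ∧ σ i₁ = 0
  · -- Two members have no initial coefficient missing, and then some variable occurs in one
    -- of the sets but not in that of a suitable one of these members; it is sent to zero.
    obtain ⟨i₀, hi₀, i₁, hi₁, hne, hs₀, hs₁⟩ := htwo
    obtain ⟨j, i₂, hi₂, hj₂, i₃, hi₃, hs₃, hj₃⟩ : ∃ j, ∃ i₂ ∈ T, j ∈ A i₂ ∧
        ∃ i₃ ∈ T, σ i₃ = 0 ∧ j ∉ A i₃ := by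
      by_contra hcon
      push Not at hcon
      have h01 : A i₀ ⊆ A i₁ := fun j hj => hcon j i₀ hi₀ hj i₁ hi₁ hs₁
      have := hT {i₀, i₁} (by simp [Finset.insert_subset_iff, hi₀, hi₁]) (by simp) 0 (A i₀) (by
        intro i hi
        rcases Finset.mem_insert.1 hi with rfl | hi
        · simp
        · rw [Finset.mem_singleton.1 hi]
          exact ⟨Nat.zero_le _, h01⟩)
      rw [Finset.sum_pair hne] at this
      have h1 := hd i₀ hi₀
      have h2 := hdpos i₁ hi₁
      omega
    have hlt : ∑ i ∈ T, ((A i).erase j).card < ∑ i ∈ T, (A i).card :=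
      Finset.sum_lt_sum (fun i _ => Finset.card_le_card (Finset.erase_subset _ _))
        ⟨i₂, hi₂, Finset.card_erase_lt_of_mem hj₂⟩
    have hd' : ∀ i ∈ T, (σ i + if j ∈ A i then 1 else 0) + ((A i).erase j).card + d i = k := by
      intro i hi
      have h1 := hd i hi
      by_cases hj : j ∈ A i
      · have h2 := Finset.card_erase_add_one hj
        simp only [hj, if_true]
        omega
      · simpa [hj] using h1
    apply DisjointSolutions.of_killVar he j
    refine ih _ (by omega) he T _ _ d hd' ?_ rfl
    intro I hI hIne c B hcB
    have hB : ∀ i ∈ I, B ⊆ A i := fun i hi => (hcB i hi).2.trans (Finset.erase_subset _ _)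
    by_cases hIT : I = T
    · have hc := (hcB i₃ (hIT ▸ hi₃)).1
      simp only [hs₃, hj₃, if_false] at hc
      exact hT I hI hIne c B fun i hi => ⟨by omega, hB i hi⟩
    by_cases hI2 : 2 ≤ I.card
    · have := hloose I hI hIT hI2 (c - 1) B fun i hi => ⟨by
        have := (hcB i hi).1
        split_ifs at this <;> omega, hB i hi⟩
      omega
    · obtain ⟨i, rfl⟩ : ∃ i, I = {i} := Finset.card_eq_one.1 (by
        have := hIne.card_pos
        omega)
      have h1 := hcB i (Finset.mem_singleton_self i)
      have h2 := hd' i (hI (Finset.mem_singleton_self i))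
      have h3 := Finset.card_le_card h1.2
      rw [Finset.sum_singleton]
      omega
  · -- At most one member has a nonzero initial coefficient, so in a relation it is zero as well.
    obtain ⟨i₀, hi₀⟩ := hTne
    obtain ⟨k, rfl⟩ : ∃ l, k = l + 1 := ⟨k - 1, by
      have := hd i₀ hi₀
      have := hdpos i₀ hi₀
      omega⟩
    have h1 := ih _ (by omega) (he.comp (Fin.strictMono_succ)) T (fun i => σ i - 1) A
      (fun i => d i - if σ i = 0 then 1 else 0) (by
        intro i hi
        have h1 := hd i hi
        have h2 := hdpos i hi
        split_ifs <;> omega) (by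
        intro I hI hIne c B hcB
        by_cases h0 : ∃ i ∈ I, σ i = 0
        · obtain ⟨i, hi, hs⟩ := h0
          have hc : c = 0 := by
            have := (hcB i hi).1
            omega
          subst hc
          have h1 := hT I hI hIne 0 B fun i hi => ⟨Nat.zero_le _, (hcB i hi).2⟩
          have h2 : ∑ i ∈ I, (d i - if σ i = 0 then 1 else 0) < ∑ i ∈ I, d i :=
            Finset.sum_lt_sum (fun i _ => Nat.sub_le _ _) ⟨i, hi, by
              have := hdpos i (hI hi)
              simp only [hs, if_true]
              omega⟩
          omega
        · have h1 := hT I hI hIne (c + 1) B fun i hi => ⟨by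
            have h2 := (hcB i hi).1
            have h3 : σ i ≠ 0 := fun h => h0 ⟨i, hi, h⟩
            omega, (hcB i hi).2⟩
          have h2 : ∑ i ∈ I, (d i - if σ i = 0 then 1 else 0) ≤ ∑ i ∈ I, d i :=
            Finset.sum_le_sum fun i _ => Nat.sub_le _ _
          omega) rfl
    intro p hp hsum
    have h0 : ∀ i ∈ T, p i 0 = 0 := by
      intro i hi
      by_cases hs : σ i = 0
      · have h2 := congrFun hsum 0
        rw [Finset.sum_apply, Finset.sum_eq_single i] at h2
        · exact h2
        · intro i' hi' hne
          refine (hp i' hi').1 0 (Nat.pos_of_ne_zero fun h => ?_)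
          exact htwo ⟨i, hi, i', hi', hne.symm, hs, h⟩
        · exact fun h => (h hi).elim
      · exact (hp i hi).1 0 (Nat.pos_of_ne_zero hs)
    have h2 := h1 (fun i m => p i m.succ) (by
      intro i hi
      refine ⟨fun m (hm : (m : ℕ) < σ i - 1) => (hp i hi).1 _ ?_, fun j hj => ?_⟩
      · rw [Fin.val_succ]
        omega
      · have := (hp i hi).2 j hj
        rwa [Fin.sum_univ_succ, h0 i hi, zero_mul, zero_add] at this) (by
      ext1 m
      have := congrFun hsum m.succ
      rw [Finset.sum_apply] at this
      rw [Finset.sum_apply]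
      exact this)
    intro i hi
    ext1 m
    refine Fin.cases (h0 i hi) (fun m => ?_) m
    exact congrFun (h2 i hi) m

/-! ### Semicontinuity of ranks and of intersections -/

/-- Lower semicontinuity of the rank: a nonzero minor of maximal size at one specialization stays
nonzero on a nonempty open set of specializations. -/
theorem exists_forall_rank_map_le {R L₀ m n : Type*} [CommRing R] [Field L₀] [Fintype m]
    [Fintype n] (C : Matrix m n R) (φ₀ : R →+* L₀) :
    ∃ P : R, φ₀ P ≠ 0 ∧ ∀ {L : Type u} [Field L] (φ : R →+* L), φ P ≠ 0 →
      (C.map φ₀).rank ≤ (C.map φ).rank := by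
  classical
  obtain ⟨γ, a, ha, hspan, hli⟩ := exists_linearIndependent' L₀ (C.map φ₀).col
  have : Finite γ := Finite.of_injective a ha
  have := Fintype.ofFinite γ
  have hcard : (C.map φ₀).rank = Fintype.card γ := by
    rw [Matrix.rank_eq_finrank_span_cols, ← hspan, finrank_span_eq_card hli]
  set D := (C.map φ₀).submatrix id a with hD
  have hrank : D.rank = Fintype.card γ := by
    rw [Matrix.rank_eq_finrank_span_cols]
    exact finrank_span_eq_card hli
  obtain ⟨γ', a', ha', hspan', hli'⟩ := exists_linearIndependent' L₀ D.row
  have : Finite γ' := Finite.of_injective a' ha'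
  have := Fintype.ofFinite γ'
  have hcard' : Fintype.card γ' = Fintype.card γ := by
    rw [← hrank, Matrix.rank_eq_finrank_span_row, ← hspan', finrank_span_eq_card hli']
  let E : γ ≃ γ' := (Fintype.equivOfCardEq hcard').symm
  refine ⟨(C.submatrix (a' ∘ E) a).det, ?_, fun {L} _ φ hφ => ?_⟩
  · have h1 : LinearIndependent L₀ (D.submatrix (a' ∘ E) id).row := hli'.comp E E.injective
    have h2 := (Matrix.isUnit_iff_isUnit_det _).1 (Matrix.linearIndependent_rows_iff_isUnit.1 h1)
    rw [RingHom.map_det]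
    exact h2.ne_zero
  · rw [hcard, ← Matrix.rank_of_det_ne_zero (A := (C.map φ).submatrix (a' ∘ E) a)
      (by rw [RingHom.map_det] at hφ; exact hφ)]
    exact Matrix.rank_submatrix_le _ _ _

theorem mem_colSpan_iff {F ι κ : Type*} [Field F] {G : Matrix ι κ F} {S : Finset κ} {v : ι → F} :
    v ∈ colSpan G (S : Set κ) ↔ ∃ x : S → F, ∀ r, v r = ∑ j : S, G r j * x j := by
  classical
  rw [colSpan, Set.image_eq_range, Submodule.mem_span_range_iff_exists_fun]
  refine exists_congr fun x => ?_
  rw [eq_comm, funext_iff]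
  refine forall_congr' fun r => ?_
  rw [Finset.sum_apply]
  simp only [Pi.smul_apply, smul_eq_mul, mul_comm]
  rfl

theorem finrank_colSpan_le {F ι κ : Type*} [Field F] [Finite ι] (G : Matrix ι κ F)
    (S : Finset κ) : Module.finrank F (colSpan G (S : Set κ)) ≤ S.card := by
  classical
  rw [colSpan, ← Finset.coe_image]
  exact (finrank_span_finset_le_card _).trans Finset.card_image_le

theorem linearIndepOn_iff_card_le_finrank_colSpan {F ι κ : Type*} [Field F] (G : Matrix ι κ F)
    (S : Finset κ) : LinearIndepOn F (fun j i => G i j) (S : Set κ) ↔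
      S.card ≤ Module.finrank F (colSpan G (S : Set κ)) := by
  rw [LinearIndepOn, linearIndependent_iff_card_le_finrank_span, colSpan, Set.image_eq_range]
  simp [Set.finrank]

/-- The columns with index in `S` are independent on a nonempty open set of specializations as
soon as they are so at one of them. -/
theorem exists_forall_linearIndepOn {R L₀ N : Type*} [CommRing R] [Field L₀] {k : ℕ}
    (M : Matrix (Fin k) N R) (S : Finset N) (φ₀ : R →+* L₀)
    (h : LinearIndepOn L₀ (fun j r => (M.map φ₀) r j) (S : Set N)) :
    ∃ P : R, φ₀ P ≠ 0 ∧ ∀ {L : Type u} [Field L] (φ : R →+* L), φ P ≠ 0 →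
      LinearIndepOn L (fun j r => (M.map φ) r j) (S : Set N) := by
  have key : ∀ {L : Type _} [Field L] (φ : R →+* L),
      Module.finrank L (colSpan (M.map φ) (S : Set N)) =
        ((M.submatrix id (fun j : S => (j : N))).map φ).rank := by
    intro L _ φ
    rw [Matrix.rank_eq_finrank_span_cols, colSpan, Set.image_eq_range]
    rfl
  have key₀ : Module.finrank L₀ (colSpan (M.map φ₀) (S : Set N)) =
        ((M.submatrix id (fun j : S => (j : N))).map φ₀).rank := by
    rw [Matrix.rank_eq_finrank_span_cols, colSpan, Set.image_eq_range]
    rfl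
  obtain ⟨P, hP, hP'⟩ := exists_forall_rank_map_le (M.submatrix id (fun j : S => (j : N))) φ₀
  refine ⟨P, hP, fun {L} _ φ hφ => ?_⟩
  rw [linearIndepOn_iff_card_le_finrank_colSpan] at h ⊢
  rw [key]
  rw [key₀] at h
  exact h.trans (hP' φ hφ)

open Classical in
/-- The matrix of the linear system `v = ∑ j ∈ S i, x i j • (column j of M)`, for all `i`, in the
unknowns `v` and `x`; the `v` that occur in solutions make up the intersection of the column
spaces. -/
noncomputable def intersectionMatrix {R N ι : Type*} [CommRing R] {k : ℕ} (M : Matrix (Fin k) N R)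
    (S : ι → Finset N) : Matrix (ι × Fin k) (Fin k ⊕ Σ i, S i) R :=
  fun a b => Sum.elim (fun c => if a.2 = c then 1 else 0)
    (fun y => if a.1 = y.1 then -M a.2 y.2 else 0) b

theorem intersectionMatrix_map {R R' N ι : Type*} [CommRing R] [CommRing R'] {k : ℕ}
    (M : Matrix (Fin k) N R) (S : ι → Finset N) (φ : R →+* R') :
    (intersectionMatrix M S).map φ = intersectionMatrix (M.map φ) S := by
  ext a b
  rcases b with c | y
  · simp only [intersectionMatrix, Matrix.map_apply, Sum.elim_inl]
    split_ifs <;> simp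
  · simp only [intersectionMatrix, Matrix.map_apply, Sum.elim_inr]
    split_ifs <;> simp

theorem intersectionMatrix_mulVec {R N ι : Type*} [CommRing R] {k : ℕ} [Fintype ι]
    (M : Matrix (Fin k) N R) (S : ι → Finset N) (x : Fin k ⊕ (Σ i, S i) → R) (i : ι)
    (r : Fin k) : (intersectionMatrix M S).mulVec x (i, r) =
      x (Sum.inl r) - ∑ j : S i, M r j * x (Sum.inr ⟨i, j⟩) := by
  classical
  rw [Matrix.mulVec, dotProduct, Fintype.sum_sum_type, Fintype.sum_sigma, sub_eq_add_neg]
  congr 1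
  · rw [Finset.sum_eq_single r]
    · simp [intersectionMatrix]
    · intro c _ hc
      simp [intersectionMatrix, hc.symm]
    · simp
  · rw [Finset.sum_eq_single i, ← Finset.sum_neg_distrib]
    · simp [intersectionMatrix]
    · intro c _ hc
      simp [intersectionMatrix, hc.symm]
    · simp

theorem map_ker_intersectionMatrix {L N ι : Type*} [Field L] {k : ℕ} [Fintype ι]
    (G : Matrix (Fin k) N L) (S : ι → Finset N) :
    (LinearMap.ker (intersectionMatrix G S).mulVecLin).map (LinearMap.funLeft L L Sum.inl) =
      ⨅ i, colSpan G (S i : Set N) := by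
  ext v
  simp only [Submodule.mem_map, LinearMap.mem_ker, Submodule.mem_iInf, Matrix.mulVecLin_apply]
  constructor
  · rintro ⟨x, hx, rfl⟩ i
    refine mem_colSpan_iff.2 ⟨fun j => x (Sum.inr ⟨i, j⟩), fun r => ?_⟩
    have := congrFun hx (i, r)
    rw [intersectionMatrix_mulVec] at this
    exact sub_eq_zero.1 this
  · intro h
    choose x hx using fun i => mem_colSpan_iff.1 (h i)
    refine ⟨Sum.elim v fun y => x y.1 y.2, ?_, rfl⟩
    ext ⟨i, r⟩
    rw [intersectionMatrix_mulVec]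
    exact sub_eq_zero.2 (hx i r)

theorem finrank_ker_intersectionMatrix_le {L N ι : Type*} [Field L] {k : ℕ} [Fintype ι]
    (G : Matrix (Fin k) N L) (S : ι → Finset N)
    (h : ∀ i, LinearIndepOn L (fun j r => G r j) (S i : Set N)) :
    Module.finrank L (LinearMap.ker (intersectionMatrix G S).mulVecLin) ≤
      Module.finrank L (⨅ i, colSpan G (S i : Set N) : Submodule L (Fin k → L)) := by
  rw [← map_ker_intersectionMatrix]
  refine LinearMap.finrank_le_finrank_of_injective (f := (LinearMap.funLeft L L
    Sum.inl).submoduleMap (LinearMap.ker (intersectionMatrix G S).mulVecLin)) ?_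
  rw [injective_iff_map_eq_zero]
  rintro ⟨x, hx⟩ h0
  have hv : ∀ r, x (Sum.inl r) = 0 := fun r => congrFun (congrArg Subtype.val h0) r
  rw [LinearMap.mem_ker, Matrix.mulVecLin_apply] at hx
  rw [Submodule.mk_eq_zero]
  ext1 (r | ⟨i, j⟩)
  · exact hv r
  · refine Fintype.linearIndependent_iff.1 (h i) (fun j => x (Sum.inr ⟨i, j⟩)) ?_ j
    ext1 r
    have := congrFun hx (i, r)
    rw [intersectionMatrix_mulVec, hv, zero_sub, Pi.zero_apply, neg_eq_zero] at this
    rw [Finset.sum_apply, Pi.zero_apply, ← this]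
    exact Finset.sum_congr rfl fun j _ => mul_comm _ _

/-- Upper semicontinuity of the dimension of an intersection of column spaces. -/
theorem exists_forall_finrank_iInf_colSpan_le {R L₀ N ι : Type*} [CommRing R] [Field L₀] {k : ℕ}
    [Fintype ι] (M : Matrix (Fin k) N R) (S : ι → Finset N) (φ₀ : R →+* L₀)
    (h : ∀ i, LinearIndepOn L₀ (fun j r => (M.map φ₀) r j) (S i : Set N)) :
    ∃ P : R, φ₀ P ≠ 0 ∧ ∀ {L : Type u} [Field L] (φ : R →+* L), φ P ≠ 0 →
      Module.finrank L (⨅ i, colSpan (M.map φ) (S i : Set N) : Submodule L (Fin k → L)) ≤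
        Module.finrank L₀
          (⨅ i, colSpan (M.map φ₀) (S i : Set N) : Submodule L₀ (Fin k → L₀)) := by
  obtain ⟨P, hP, hP'⟩ := exists_forall_rank_map_le (intersectionMatrix M S) φ₀
  refine ⟨P, hP, fun {L} _ φ hφ => ?_⟩
  have h1 := hP' φ hφ
  rw [intersectionMatrix_map, intersectionMatrix_map] at h1
  have h2 := LinearMap.finrank_range_add_finrank_ker (intersectionMatrix (M.map φ) S).mulVecLin
  have h3 := LinearMap.finrank_range_add_finrank_ker (intersectionMatrix (M.map φ₀) S).mulVecLin
  have h4 := finrank_ker_intersectionMatrix_le _ _ h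
  have h5 := Submodule.finrank_map_le (LinearMap.funLeft L L Sum.inl)
    (LinearMap.ker (intersectionMatrix (M.map φ) S).mulVecLin)
  rw [map_ker_intersectionMatrix] at h5
  rw [Module.finrank_pi] at h2 h3
  simp only [Matrix.rank] at h1
  omega

/-! ### Extremal matrices -/

/-- The matrix `G` is extremal for the index sets `S i` if the columns in each `S i` are independent
and the sum of the annihilators of the column spaces is as large as the following necessary
condition allows: if `δ i` independent vectors are to be chosen in the `i`-th annihilator, then
those with `i ∈ I` annihilate all columns that the sets `S i`, `i ∈ I`, have in common. -/
structure IsExtremal {L N ι : Type*} [Field L] {k : ℕ} [Fintype ι] (G : Matrix (Fin k) N L)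
    (S : ι → Finset N) : Prop where
  linearIndepOn : ∀ i, LinearIndepOn L (fun j r => G r j) (S i : Set N)
  sum_le : ∀ δ : ι → ℕ, (∀ I : Finset ι, I.Nonempty → ∀ B : Finset N, (∀ i ∈ I, B ⊆ S i) →
    ∑ i ∈ I, δ i + B.card ≤ k) → ∑ i, δ i ≤ Module.finrank L
      (⨆ i, (colSpan G (S i : Set N)).dualAnnihilator : Submodule L (Module.Dual L (Fin k → L)))

theorem finrank_iInf_add_finrank_iSup_dualAnnihilator {L N ι : Type*} [Field L] {k : ℕ} [Finite ι]
    (G : Matrix (Fin k) N L) (S : ι → Finset N) :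
    Module.finrank L (⨅ i, colSpan G (S i : Set N) : Submodule L (Fin k → L)) +
      Module.finrank L (⨆ i, (colSpan G (S i : Set N)).dualAnnihilator :
        Submodule L (Module.Dual L (Fin k → L))) = k := by
  rw [← Subspace.dualAnnihilator_iInf_eq, Subspace.finrank_add_finrank_dualAnnihilator_eq,
    Module.finrank_pi, Fintype.card_fin]

/-- The condition in the definition of extremality holds for the dimensions that occur in any matrix
with independent columns, whence the name. -/
theorem IsExtremal.finrank_iSup_le {L L₀ N ι : Type*} [Field L] [Field L₀] {k : ℕ} [Fintype ι]
    {G : Matrix (Fin k) N L} {G₀ : Matrix (Fin k) N L₀} {S : ι → Finset N}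
    (h₀ : IsExtremal G₀ S) (h : ∀ i, LinearIndepOn L (fun j r => G r j) (S i : Set N)) :
    Module.finrank L (⨆ i, (colSpan G (S i : Set N)).dualAnnihilator :
        Submodule L (Module.Dual L (Fin k → L))) ≤
      Module.finrank L₀ (⨆ i, (colSpan G₀ (S i : Set N)).dualAnnihilator :
        Submodule L₀ (Module.Dual L₀ (Fin k → L₀))) := by
  classical
  -- A basis of the sum over `G` is chosen among the vectors of the summands; `δ i` counts the
  -- basis vectors that are assigned to the `i`-th summand.
  obtain ⟨b, hb, hspan, hli⟩ := exists_linearIndependent L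
    (⋃ i, ((colSpan G (S i : Set N)).dualAnnihilator : Set (Module.Dual L (Fin k → L))))
  choose f hf using fun x : b => Set.mem_iUnion.1 (hb x.2)
  have : Finite b := hli.finite
  have := Fintype.ofFinite b
  rw [Submodule.iSup_eq_span, ← hspan]
  have hcard : Module.finrank L (Submodule.span L b) = Fintype.card b := by
    have := finrank_span_eq_card hli
    rwa [Subtype.range_coe] at this
  have hfib : ∀ I : Finset ι, ∑ i ∈ I, (Finset.univ.filter fun x : b => f x = i).card =
      (Finset.univ.filter fun x : b => f x ∈ I).card := by
    intro I
    rw [Finset.card_eq_sum_card_fiberwise (f := f) (t := I) (by intro x hx; simpa using hx)]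
    refine Finset.sum_congr rfl fun i hi => ?_
    congr 1
    ext x
    simp only [Finset.mem_filter, Finset.mem_univ, true_and]
    exact ⟨fun h => ⟨h ▸ hi, h⟩, fun h => h.2⟩
  have key := h₀.sum_le (fun i => (Finset.univ.filter fun x : b => f x = i).card) (by
    rintro I ⟨i₀, hi₀⟩ B hB
    rw [hfib]
    have hBc : Module.finrank L (colSpan G (B : Set N)) = B.card :=
      le_antisymm (finrank_colSpan_le _ _)
        ((linearIndepOn_iff_card_le_finrank_colSpan _ _).1 ((h i₀).mono (by
          exact_mod_cast hB i₀ hi₀)))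
    have hsum := Subspace.finrank_add_finrank_dualAnnihilator_eq (colSpan G (B : Set N))
    rw [Module.finrank_pi, Fintype.card_fin, hBc] at hsum
    have hmem : ∀ x : {x : b // x ∈ Finset.univ.filter fun x : b => f x ∈ I},
        (x : Module.Dual L (Fin k → L)) ∈ (colSpan G (B : Set N)).dualAnnihilator := by
      rintro ⟨x, hx⟩
      refine Submodule.dualAnnihilator_anti ?_ (hf x)
      refine Submodule.span_mono (Set.image_mono ?_)
      exact_mod_cast hB _ (Finset.mem_filter.1 hx).2
    have hli' : LinearIndependent L (fun x => (⟨_, hmem x⟩ :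
        (colSpan G (B : Set N)).dualAnnihilator)) :=
      LinearIndependent.of_comp (Submodule.subtype _) (hli.comp _ Subtype.val_injective)
    have := hli'.fintype_card_le_finrank
    rw [Fintype.card_coe] at this
    omega)
  rw [hfib] at key
  rw [hcard]
  simpa using key

/-- Any two matrices that are extremal for the same index sets, over whatever fields, have
intersections of the same dimension. -/
theorem IsExtremal.finrank_iInf_eq {L L' N ι : Type*} [Field L] [Field L'] {k : ℕ} [Fintype ι]
    {G : Matrix (Fin k) N L} {G' : Matrix (Fin k) N L'} {S : ι → Finset N}
    (h : IsExtremal G S) (h' : IsExtremal G' S) :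
    Module.finrank L (⨅ i, colSpan G (S i : Set N) : Submodule L (Fin k → L)) =
      Module.finrank L' (⨅ i, colSpan G' (S i : Set N) : Submodule L' (Fin k → L')) := by
  have h1 := finrank_iInf_add_finrank_iSup_dualAnnihilator G S
  have h2 := finrank_iInf_add_finrank_iSup_dualAnnihilator G' S
  have h3 := h.finrank_iSup_le h'.linearIndepOn
  have h4 := h'.finrank_iSup_le h.linearIndepOn
  omega

/-- Extremality is an open condition on specializations. -/
theorem exists_forall_isExtremal {R L₀ N ι : Type*} [CommRing R] [Field L₀] {k : ℕ}
    [Fintype ι] (M : Matrix (Fin k) N R) (S : ι → Finset N) (φ₀ : R →+* L₀)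
    (h : IsExtremal (M.map φ₀) S) :
    ∃ P : R, φ₀ P ≠ 0 ∧ ∀ {L : Type u} [Field L] (φ : R →+* L), φ P ≠ 0 →
      IsExtremal (M.map φ) S := by
  obtain ⟨P, hP, hP'⟩ := exists_forall_finrank_iInf_colSpan_le M S φ₀ h.linearIndepOn
  choose Q hQ hQ' using fun i => exists_forall_linearIndepOn M (S i) φ₀ (h.linearIndepOn i)
  refine ⟨P * ∏ i, Q i, ?_, fun {L} _ φ hφ => ⟨fun i => ?_, fun δ hδ => ?_⟩⟩
  · rw [map_mul, map_prod]
    exact mul_ne_zero hP (Finset.prod_ne_zero_iff.2 fun i _ => hQ i)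
  · rw [map_mul, map_prod] at hφ
    exact hQ' i φ (Finset.prod_ne_zero_iff.1 (right_ne_zero_of_mul hφ) i (Finset.mem_univ i))
  · rw [map_mul] at hφ
    have h1 := hP' φ (left_ne_zero_of_mul hφ)
    have h2 := h.sum_le δ hδ
    have h3 := finrank_iInf_add_finrank_iSup_dualAnnihilator (M.map φ) S
    have h4 := finrank_iInf_add_finrank_iSup_dualAnnihilator (M.map φ₀) S
    omega

/-! ### Monomial codes in independent variables -/

/-- The matrix `[1 | V]`, where `V` has the entries `β j ^ e m`. -/
def basisCode {R κ : Type*} [CommRing R] {k : ℕ} (e : Fin k → ℕ) (β : κ → R) :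
    Matrix (Fin k) (Fin k ⊕ κ) R :=
  Matrix.fromCols 1 fun m j => β j ^ e m

/-- The columns that span `U_{≤ s} + V_A` in the matrix `[U | V]`. -/
def prefixUnion {κ : Type*} (k s : ℕ) (A : Finset κ) : Finset (Fin k ⊕ κ) :=
  (Finset.univ.filter fun m : Fin k => (m : ℕ) < s).disjSum A

theorem card_prefixUnion {κ : Type*} {k s : ℕ} (hs : s ≤ k) (A : Finset κ) :
    (prefixUnion k s A).card = s + A.card := by
  rw [prefixUnion, Finset.card_disjSum, Fin.card_filter_val_lt, min_eq_right hs]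

/-- Functionals that annihilate `U_{≤ s} + V_A` correspond to polynomials with prescribed zeros. -/
theorem mem_dualAnnihilator_basisCode {L κ : Type*} [Field L] {k : ℕ} {e : Fin k → ℕ} {β : κ → L}
    {s : ℕ} {A : Finset κ} {f : Module.Dual L (Fin k → L)} :
    f ∈ (colSpan (basisCode e β) (prefixUnion k s A : Set (Fin k ⊕ κ))).dualAnnihilator ↔
      Vanishes e β s A (fun m => f (Pi.single m 1)) := by
  have hf : ∀ j, f (fun m => β j ^ e m) = ∑ m, f (Pi.single m 1) * β j ^ e m := by
    intro j
    rw [LinearMap.pi_apply_eq_sum_univ f]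
    refine Finset.sum_congr rfl fun m _ => ?_
    rw [smul_eq_mul, mul_comm]
    congr 2
    ext i
    simp [Pi.single_apply, eq_comm]
  have h1 : ∀ m : Fin k, (fun i => basisCode e β i (Sum.inl m)) = Pi.single m (1 : L) := by
    intro m
    ext i
    change (1 : Matrix (Fin k) (Fin k) L) i m = _
    rw [Matrix.one_apply, Pi.single_apply]
  rw [Submodule.mem_dualAnnihilator, colSpan]
  constructor
  · intro h
    refine ⟨fun m hm => ?_, fun j hj => ?_⟩
    · change f (Pi.single m 1) = 0
      rw [← h1]
      exact h _ (Submodule.subset_span ⟨Sum.inl m, by simpa [prefixUnion] using hm, rfl⟩)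
    · rw [← hf]
      exact h _ (Submodule.subset_span ⟨Sum.inr j, by simpa [prefixUnion] using hj, rfl⟩)
  · intro h w hw
    refine (Submodule.span_le (p := LinearMap.ker f)).2 ?_ hw
    rintro _ ⟨m | j, hm, rfl⟩
    · simp only [h1, SetLike.mem_coe, LinearMap.mem_ker]
      exact h.1 m (by simpa [prefixUnion] using hm)
    · change f (fun m => β j ^ e m) = 0
      rw [hf]
      exact h.2 j (by simpa [prefixUnion] using hm)

/-- A relation over the field of fractions can be cleared of denominators. -/
theorem DisjointSolutions.of_isFractionRing {R L κ ι : Type*} [CommRing R] [IsDomain R] [Field L]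
    [Algebra R L] [IsFractionRing R L] {k : ℕ} {e : Fin k → ℕ} {β : κ → R} {T : Finset ι}
    {σ : ι → ℕ} {A : ι → Finset κ} (h : DisjointSolutions e β T σ A) :
    DisjointSolutions e (fun j => algebraMap R L (β j)) T σ A := by
  classical
  intro p hp hsum
  obtain ⟨b, hb⟩ := IsLocalization.exist_integer_multiples (nonZeroDivisors R)
    (T ×ˢ (Finset.univ : Finset (Fin k))) (fun x => p x.1 x.2)
  have hb0 : algebraMap R L b ≠ 0 :=
    IsFractionRing.to_map_ne_zero_of_mem_nonZeroDivisors b.2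
  have hinj := IsFractionRing.injective R L
  have hq : ∀ i m, ∃ r : R, i ∈ T → algebraMap R L r = algebraMap R L b * p i m := by
    intro i m
    by_cases hi : i ∈ T
    · obtain ⟨r, hr⟩ := hb (i, m) (by simp [hi])
      exact ⟨r, fun _ => by rw [hr, Algebra.smul_def]⟩
    · exact ⟨0, fun h => (hi h).elim⟩
  choose q hq using hq
  have := h q (fun i hi => ⟨fun m hm => hinj ?_, fun j hj => hinj ?_⟩) (by
    ext1 m
    apply hinj
    have := congrFun hsum m
    rw [Finset.sum_apply] at this
    rw [Finset.sum_apply, map_sum, Finset.sum_congr rfl fun i hi => hq i m hi, ← Finset.mul_sum,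
      this]
    simp)
  · intro i hi
    ext1 m
    have h1 := hq i m hi
    rw [this i hi, Pi.zero_apply, map_zero] at h1
    exact (mul_eq_zero.1 h1.symm).resolve_left hb0
  · rw [hq i m hi, (hp i hi).1 m hm, mul_zero, map_zero]
  · rw [map_sum, map_zero, ← mul_zero (algebraMap R L b), ← (hp i hi).2 j hj,
      Finset.mul_sum]
    refine Finset.sum_congr rfl fun m _ => ?_
    rw [map_mul, hq i m hi, map_pow, mul_assoc]

/-- The sum map on the product of the `P i` is injective, with values in the span of the `Q i`. -/
theorem sum_finrank_le_of_disjoint {L V ι : Type*} [Field L] [AddCommGroup V] [Module L V]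
    [FiniteDimensional L V] [Fintype ι] (P Q : ι → Submodule L V) (hPQ : ∀ i, P i ≤ Q i)
    (h : ∀ p : ι → V, (∀ i, p i ∈ P i) → ∑ i, p i = 0 → ∀ i, p i = 0) :
    ∑ i, Module.finrank L (P i) ≤ Module.finrank L (⨆ i, Q i : Submodule L V) := by
  classical
  rw [← Module.finrank_pi_fintype L]
  let g : (∀ i, P i) →ₗ[L] V := ∑ i, (P i).subtype ∘ₗ LinearMap.proj i
  have hg : ∀ p, g p = ∑ i, (p i : V) := fun p => by simp [g]
  refine LinearMap.finrank_le_finrank_of_injective (f := g.codRestrict (⨆ i, Q i) fun p => ?_) ?_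
  · rw [hg]
    exact Submodule.sum_mem _ fun i _ => Submodule.mem_iSup_of_mem i (hPQ i (p i).2)
  · rw [injective_iff_map_eq_zero]
    intro p hp
    have h0 : g p = 0 := congrArg Subtype.val hp
    rw [hg] at h0
    ext1 i
    exact Subtype.ext (h (fun i => p i) (fun i => (p i).2) h0 i)

/-- The variables of the rational function field over which `[1 | V]` is shown to be extremal: the
points `κ` of the code and, for every `i`, a supply of `k` fresh points. -/
abbrev ExtendedPoints (κ ι : Type*) (k : ℕ) : Type _ := κ ⊕ (ι × Fin k)

/-- The rational function field in the variables `ExtendedPoints κ ι k`. -/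
abbrev ExtendedField (K κ ι : Type*) [Field K] (k : ℕ) : Type _ :=
  FractionRing (MvPolynomial (ExtendedPoints κ ι k) K)

/-- The variable with index `j` as an element of the rational function field. -/
noncomputable def extendedPoint (K : Type*) {κ ι : Type*} [Field K] {k : ℕ}
    (j : ExtendedPoints κ ι k) : ExtendedField K κ ι k :=
  algebraMap (MvPolynomial (ExtendedPoints κ ι k) K) _ (MvPolynomial.X j)

open Classical in
/-- The set `A` together with `t` of the fresh points that belong to `i`. -/
noncomputable def addFresh {κ ι : Type*} (k : ℕ) (A : Finset κ) (i : ι) (t : ℕ) :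
    Finset (ExtendedPoints κ ι k) :=
  A.disjSum ((Finset.univ.filter fun r : Fin k => (r : ℕ) < t).map
    ⟨Prod.mk i, Prod.mk_right_injective i⟩)

theorem card_addFresh {κ ι : Type*} {k t : ℕ} (A : Finset κ) (i : ι) (ht : t ≤ k) :
    (addFresh k A i t).card = A.card + t := by
  rw [addFresh, Finset.card_disjSum, Finset.card_map, Fin.card_filter_val_lt, min_eq_right ht]

theorem inr_mem_addFresh {κ ι : Type*} {k t : ℕ} {A : Finset κ} {i i' : ι} {r : Fin k}
    (h : Sum.inr (i', r) ∈ addFresh k A i t) : i' = i := by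
  rw [addFresh, Finset.inr_mem_disjSum, Finset.mem_map] at h
  obtain ⟨_, _, h⟩ := h
  exact (congrArg Prod.fst h).symm

theorem colSpan_basisCode_le_addFresh {K κ ι : Type*} [Field K] {k : ℕ} (e : Fin k → ℕ) (s t : ℕ)
    (A : Finset κ) (i : ι) :
    colSpan (basisCode e fun j : κ => extendedPoint K (Sum.inl j : ExtendedPoints κ ι k))
        (prefixUnion k s A : Set (Fin k ⊕ κ)) ≤
      colSpan (basisCode e (extendedPoint K : ExtendedPoints κ ι k → _))
        (prefixUnion k s (addFresh k A i t) : Set (Fin k ⊕ ExtendedPoints κ ι k)) := by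
  refine Submodule.span_mono ?_
  rintro _ ⟨m | j, hm, rfl⟩
  · exact ⟨Sum.inl m, by simpa [prefixUnion] using hm, rfl⟩
  · exact ⟨Sum.inr (Sum.inl j), by simpa [prefixUnion, addFresh] using hm, rfl⟩

theorem linearIndepOn_basisCode {K κ ι : Type*} [Field K] {k : ℕ} {e : Fin k → ℕ}
    (he : StrictMono e) (i : ι) {s : ℕ} {A : Finset κ} (hs : s + A.card ≤ k) :
    LinearIndepOn (ExtendedField K κ ι k)
      (fun j r => basisCode e
        (fun j : κ => extendedPoint K (Sum.inl j : ExtendedPoints κ ι k)) r j)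
      (prefixUnion k s A : Set (Fin k ⊕ κ)) := by
  -- With enough fresh points added the annihilator is zero, so the columns form a basis.
  set B := addFresh k A i (k - (s + A.card)) with hB
  have hBc : B.card = A.card + (k - (s + A.card)) := card_addFresh A i (by omega)
  set V := colSpan (basisCode e (extendedPoint K : ExtendedPoints κ ι k → _))
    (prefixUnion k s B : Set (Fin k ⊕ ExtendedPoints κ ι k)) with hV
  have h0 : V.dualAnnihilator = ⊥ := by
    rw [eq_bot_iff]
    intro f hf
    have h1 := ((disjointSolutions_bool (K := K) he (s := s) (A := B) (by omega)).of_isFractionRing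
      (L := ExtendedField K κ ι k)).eq_zero_of_vanishes (mem_dualAnnihilator_basisCode.1 hf)
    rw [Submodule.mem_bot]
    refine LinearMap.pi_ext' fun m => LinearMap.ext_ring ?_
    exact congrFun h1 m
  have h1 := Subspace.finrank_add_finrank_dualAnnihilator_eq V
  rw [h0, finrank_bot, add_zero, Module.finrank_pi, Fintype.card_fin] at h1
  have h2 := (linearIndepOn_iff_card_le_finrank_colSpan _ _).2 ((card_prefixUnion
    (by omega : s ≤ k) B).le.trans ((by omega : _ ≤ k).trans h1.ge))
  refine (h2.mono ?_).comp_of_image (s := (prefixUnion k s A : Set (Fin k ⊕ κ)))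
    (f := Sum.map id Sum.inl) (Sum.map_injective.2 ⟨fun _ _ h => h, Sum.inl_injective⟩).injOn
    |>.congr ?_
  · rintro _ ⟨m | j, hm, rfl⟩
    · simpa [prefixUnion] using hm
    · simpa [prefixUnion, hB, addFresh] using hm
  · rintro (m | j) _ <;> rfl

/-- Over the rational function field the matrix `[1 | V]` is extremal. -/
theorem isExtremal_basisCode {K κ ι : Type*} [Field K] [Fintype ι] {k : ℕ} {e : Fin k → ℕ}
    (he : StrictMono e) (σ : ι → ℕ) (A : ι → Finset κ) (hσ : ∀ i, σ i + (A i).card ≤ k) :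
    IsExtremal (basisCode e fun j : κ => extendedPoint K (Sum.inl j : ExtendedPoints κ ι k))
      (fun i => prefixUnion k (σ i) (A i)) := by
  classical
  refine ⟨fun i => linearIndepOn_basisCode he i (hσ i), fun δ hδ => ?_⟩
  -- Adding fresh points cuts the `i`-th annihilator down to dimension `δ i`.
  have hδ1 : ∀ i, σ i + (A i).card + δ i ≤ k := fun i => by
    have := hδ {i} (Finset.singleton_nonempty i) (prefixUnion k (σ i) (A i)) (by simp)
    rw [Finset.sum_singleton, card_prefixUnion ((Nat.le_add_right _ _).trans (hσ i))] at this
    omega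
  set B : ι → Finset (ExtendedPoints κ ι k) := fun i =>
    addFresh k (A i) i (k - (σ i + (A i).card + δ i)) with hB
  have hBc : ∀ i, σ i + (B i).card + δ i = k := fun i => by
    have := hδ1 i
    rw [hB, card_addFresh _ _ (by omega)]
    omega
  have hdis : DisjointSolutions e
      (MvPolynomial.X : _ → MvPolynomial (ExtendedPoints κ ι k) K) Finset.univ σ B := by
    refine disjointSolutions_of_card_le he _ σ B δ (fun i _ => hBc i) ?_
    intro I _ hI c C hC
    by_cases hI2 : ∃ i ∈ I, ∃ i' ∈ I, i ≠ i'
    · -- No fresh point is common to two of the sets.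
      obtain ⟨i, hi, i', hi', hne⟩ := hI2
      have hCA : C = (C.preimage Sum.inl Sum.inl_injective.injOn).map Function.Embedding.inl := by
        ext (j | ⟨x, r⟩)
        · simp
        · simp only [Finset.mem_map, Function.Embedding.inl_apply, reduceCtorEq, and_false,
            exists_false, iff_false]
          intro hx
          exact hne ((inr_mem_addFresh ((hC i hi).2 hx)).symm.trans
            (inr_mem_addFresh ((hC i' hi').2 hx)))
      have hck : c ≤ k := (hC i hi).1.trans ((Nat.le_add_right _ _).trans (hσ i))
      have := hδ I hI (prefixUnion k c (C.preimage Sum.inl Sum.inl_injective.injOn)) (by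
        intro l hl
        refine Finset.disjSum_mono (Finset.monotone_filter_right _ fun m _ hm => ?_) ?_
        · exact lt_of_lt_of_le hm (hC l hl).1
        · intro j hj
          have := (hC l hl).2 (Finset.mem_preimage.1 hj)
          simpa [hB, addFresh] using this)
      rw [card_prefixUnion hck] at this
      rw [hCA, Finset.card_map]
      omega
    · obtain ⟨i, hi⟩ := hI
      have hIi : I = {i} := by
        refine Finset.eq_singleton_iff_unique_mem.2 ⟨hi, fun i' hi' => ?_⟩
        by_contra hne
        exact hI2 ⟨i', hi', i, hi, hne⟩
      have h1 := hC i hi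
      have h2 := Finset.card_le_card h1.2
      have h3 := hBc i
      rw [hIi, Finset.sum_singleton]
      omega
  have hdis' := hdis.of_isFractionRing (L := ExtendedField K κ ι k)
  refine le_trans ?_ (sum_finrank_le_of_disjoint
    (fun i => (colSpan (basisCode e (extendedPoint K : ExtendedPoints κ ι k → _))
      (prefixUnion k (σ i) (B i) : Set (Fin k ⊕ ExtendedPoints κ ι k))).dualAnnihilator) _
    (fun i => Submodule.dualAnnihilator_anti (colSpan_basisCode_le_addFresh e (σ i) _ (A i) i)) ?_)
  · refine Finset.sum_le_sum fun i _ => ?_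
    have h1 := Subspace.finrank_add_finrank_dualAnnihilator_eq
      (colSpan (basisCode e (extendedPoint K : ExtendedPoints κ ι k → _))
        (prefixUnion k (σ i) (B i) : Set (Fin k ⊕ ExtendedPoints κ ι k)))
    have h2 := finrank_colSpan_le (basisCode e (extendedPoint K : ExtendedPoints κ ι k → _))
      (prefixUnion k (σ i) (B i))
    have h3 := hBc i
    rw [card_prefixUnion (by omega)] at h2
    rw [Module.finrank_pi, Fintype.card_fin] at h1
    omega
  · intro f hf hsum i
    have := hdis' (fun i m => f i (Pi.single m 1))
      (fun i _ => mem_dualAnnihilator_basisCode.1 (hf i)) (by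
        ext1 m
        have := LinearMap.congr_fun hsum (Pi.single m 1)
        rw [LinearMap.sum_apply] at this
        rw [Finset.sum_apply]
        exact this) i (Finset.mem_univ i)
    refine LinearMap.pi_ext' fun m => LinearMap.ext_ring ?_
    exact congrFun this m

/-! ### Transfer to generic matrices and to generic points -/

/-- The matrix `G`, with columns `Fin k ⊕ κ`, is extremal for every finite family of the sets
`prefixUnion k s A` with at most `k` elements. -/
def IsPrefixExtremal {L κ : Type*} [Field L] {k : ℕ} (G : Matrix (Fin k) (Fin k ⊕ κ) L) : Prop :=
  ∀ Q : Finset (ℕ × Finset κ), (∀ q ∈ Q, q.1 + q.2.card ≤ k) →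
    IsExtremal G fun q : Q => prefixUnion k q.1.1 q.1.2

theorem RingHom.map_one_matrix_apply {R R' m : Type*} [CommRing R] [CommRing R'] [DecidableEq m]
    (φ : R →+* R') (i j : m) : φ ((1 : Matrix m m R) i j) = (1 : Matrix m m R') i j := by
  rw [Matrix.one_apply, Matrix.one_apply]
  split_ifs <;> simp

theorem basisCode_map {R R' κ : Type*} [CommRing R] [CommRing R'] {k : ℕ} (e : Fin k → ℕ)
    (β : κ → R) (φ : R →+* R') : (basisCode e β).map φ = basisCode e fun j => φ (β j) := by
  ext m (l | j)
  · exact φ.map_one_matrix_apply m l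
  · exact map_pow φ _ _

/-- A matrix over `R` that specializes to `[1 | V]` over the polynomial ring is extremal at almost
all specializations. -/
theorem exists_forall_isExtremal_of_map {R K κ : Type*} [CommRing R] [Field K] {k : ℕ}
    {e : Fin k → ℕ} (he : StrictMono e) (M : Matrix (Fin k) (Fin k ⊕ κ) R)
    (χ : R →+* MvPolynomial κ K) (hχ : M.map χ = basisCode e MvPolynomial.X)
    (Q : Finset (ℕ × Finset κ)) (hQ : ∀ q ∈ Q, q.1 + q.2.card ≤ k) :
    ∃ P : R, P ≠ 0 ∧ ∀ {L : Type u} [Field L] (φ : R →+* L), φ P ≠ 0 →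
      IsExtremal (M.map φ) fun q : Q => prefixUnion k q.1.1 q.1.2 := by
  let ρ : MvPolynomial κ K →+* ExtendedField K κ Q k :=
    (algebraMap (MvPolynomial (ExtendedPoints κ Q k) K) _).comp
      (MvPolynomial.rename Sum.inl).toRingHom
  have hρ : M.map (ρ.comp χ) =
      basisCode e fun j : κ => extendedPoint K (Sum.inl j : ExtendedPoints κ Q k) := by
    have h1 : M.map (ρ.comp χ) = (M.map χ).map ρ := by
      rw [Matrix.map_map]
      rfl
    rw [h1, hχ, basisCode_map]
    congr 1
    ext1 j
    simp [ρ, extendedPoint]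
  have h := isExtremal_basisCode (K := K) he (fun q : Q => q.1.1) (fun q => q.1.2)
    fun q => hQ _ q.2
  rw [← hρ] at h
  obtain ⟨P, hP, hP'⟩ := exists_forall_isExtremal M _ _ h
  exact ⟨P, fun h => hP (by rw [h, map_zero]), hP'⟩

theorem isPrefixExtremal_map_of_injective {R K κ : Type*} {L : Type u} [CommRing R] [Field K]
    [Field L] {k : ℕ} {e : Fin k → ℕ} (he : StrictMono e) (M : Matrix (Fin k) (Fin k ⊕ κ) R)
    (χ : R →+* MvPolynomial κ K) (hχ : M.map χ = basisCode e MvPolynomial.X)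
    (φ : R →+* L) (hφ : Function.Injective φ) : IsPrefixExtremal (M.map φ) := by
  intro Q hQ
  obtain ⟨P, hP, hP'⟩ := exists_forall_isExtremal_of_map he M χ hχ Q hQ
  exact hP' φ fun h => hP (hφ (h.trans (map_zero φ).symm))

/-- There are only finitely many families to consider, so one polynomial serves for all. -/
theorem exists_forall_isPrefixExtremal_basisCode (K κ : Type*) [Field K] [Finite κ] {k : ℕ}
    {e : Fin k → ℕ} (he : StrictMono e) :
    ∃ P : MvPolynomial κ K, P ≠ 0 ∧ ∀ {L : Type u} [Field L] (φ : MvPolynomial κ K →+* L),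
      φ P ≠ 0 → IsPrefixExtremal (basisCode e fun j => φ (MvPolynomial.X j)) := by
  classical
  have := Fintype.ofFinite κ
  have h : ∀ Q : Finset (ℕ × Finset κ), ∃ P : MvPolynomial κ K, P ≠ 0 ∧
      ∀ {L : Type u} [Field L] (φ : MvPolynomial κ K →+* L), φ P ≠ 0 →
        (∀ q ∈ Q, q.1 + q.2.card ≤ k) →
        IsExtremal (basisCode e fun j => φ (MvPolynomial.X j))
          fun q : Q => prefixUnion k q.1.1 q.1.2 := by
    intro Q
    by_cases hQ : ∀ q ∈ Q, q.1 + q.2.card ≤ k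
    · obtain ⟨P, hP, hP'⟩ := exists_forall_isExtremal_of_map he
        (basisCode e (MvPolynomial.X : κ → MvPolynomial κ K)) (RingHom.id _) (by
          rw [basisCode_map]
          rfl) Q hQ
      refine ⟨P, hP, fun φ hφ _ => ?_⟩
      rw [← basisCode_map]
      exact hP' φ hφ
    · exact ⟨1, one_ne_zero, fun _ _ h => (hQ h).elim⟩
  choose P hP hP' using h
  refine ⟨∏ Q ∈ (Finset.range (k + 1) ×ˢ (Finset.univ : Finset (Finset κ))).powerset, P Q,
    Finset.prod_ne_zero_iff.2 fun Q _ => hP Q, fun φ hφ Q hQ => hP' Q φ ?_ hQ⟩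
  rw [map_prod] at hφ
  refine Finset.prod_ne_zero_iff.1 hφ Q (Finset.mem_powerset.2 fun q hq => ?_)
  have := hQ q hq
  simp only [Finset.mem_product, Finset.mem_range, Finset.mem_univ, and_true]
  omega

/-- Both sides are the whole space, as `k` of the columns are independent. -/
theorem IsPrefixExtremal.colSpan_eq_of_subset {L κ : Type*} [Field L] {k : ℕ}
    {G : Matrix (Fin k) (Fin k ⊕ κ) L} (h : IsPrefixExtremal G) {s : ℕ} {A B : Finset κ}
    (hBA : B ⊆ A) (hs : s + B.card = k) :
    colSpan G (prefixUnion k s A : Set (Fin k ⊕ κ)) =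
      colSpan G (prefixUnion k s B : Set (Fin k ⊕ κ)) := by
  have h1 := (linearIndepOn_iff_card_le_finrank_colSpan _ _).1
    ((h {(s, B)} (by simp [hs])).linearIndepOn ⟨(s, B), Finset.mem_singleton_self _⟩)
  change (prefixUnion k s B).card ≤
    Module.finrank L (colSpan G (prefixUnion k s B : Set (Fin k ⊕ κ))) at h1
  rw [card_prefixUnion (by omega), hs] at h1
  have h2 : colSpan G (prefixUnion k s B : Set (Fin k ⊕ κ)) = ⊤ := by
    refine Submodule.eq_top_of_finrank_eq (le_antisymm (Submodule.finrank_le _) ?_)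
    rwa [Module.finrank_pi, Fintype.card_fin]
  rw [h2, eq_top_iff, ← h2]
  refine Submodule.span_mono (Set.image_mono ?_)
  exact Finset.coe_subset.2 (Finset.disjSum_mono le_rfl hBA)

open Classical in
theorem IsPrefixExtremal.iInf_colSpan_eq {L κ ι : Type*} [Field L] [Fintype ι]
    {k : ℕ} {G : Matrix (Fin k) (Fin k ⊕ κ) L} (h : IsPrefixExtremal G) (σ : ι → ℕ)
    (A B : ι → Finset κ) (hBA : ∀ i, B i ⊆ A i)
    (hB : ∀ i, B i = A i ∨ σ i + (B i).card = k) :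
    (⨅ i, colSpan G (prefixUnion k (σ i) (A i) : Set (Fin k ⊕ κ))) =
      ⨅ q : Finset.univ.image (fun i => (σ i, B i)),
        colSpan G (prefixUnion k q.1.1 q.1.2 : Set (Fin k ⊕ κ)) := by
  have key : ∀ i, colSpan G (prefixUnion k (σ i) (A i) : Set (Fin k ⊕ κ)) =
      colSpan G (prefixUnion k (σ i) (B i) : Set (Fin k ⊕ κ)) := by
    intro i
    rcases hB i with h0 | h0
    · rw [h0]
    · exact h.colSpan_eq_of_subset (hBA i) h0
  simp only [key]
  refine le_antisymm (le_iInf ?_) (le_iInf fun i => ?_)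
  · rintro ⟨q, hq⟩
    obtain ⟨i, _, rfl⟩ := Finset.mem_image.1 hq
    exact iInf_le _ i
  · exact iInf_le (fun q : Finset.univ.image (fun i => (σ i, B i)) =>
      colSpan G (prefixUnion k q.1.1 q.1.2 : Set (Fin k ⊕ κ)))
      ⟨(σ i, B i), Finset.mem_image_of_mem _ (Finset.mem_univ i)⟩

theorem IsPrefixExtremal.finrank_iInf_eq {L L' κ ι : Type*} [Field L] [Field L'] [Finite ι]
    {k : ℕ} {G : Matrix (Fin k) (Fin k ⊕ κ) L} {G' : Matrix (Fin k) (Fin k ⊕ κ) L'}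
    (h : IsPrefixExtremal G) (h' : IsPrefixExtremal G') (σ : ι → ℕ) (A : ι → Finset κ)
    (hσ : ∀ i, σ i ≤ k) :
    Module.finrank L (⨅ i, colSpan G (prefixUnion k (σ i) (A i) : Set (Fin k ⊕ κ)) :
        Submodule L (Fin k → L)) =
      Module.finrank L' (⨅ i, colSpan G' (prefixUnion k (σ i) (A i) : Set (Fin k ⊕ κ)) :
        Submodule L' (Fin k → L')) := by
  classical
  have := Fintype.ofFinite ι
  -- Sets with more than `k` elements are cut down to `k` elements, which span the whole space.
  have hB : ∀ i, ∃ B ⊆ A i, σ i + B.card ≤ k ∧ (B = A i ∨ σ i + B.card = k) := by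
    intro i
    by_cases hA : σ i + (A i).card ≤ k
    · exact ⟨A i, subset_rfl, hA, Or.inl rfl⟩
    · obtain ⟨B, hBA, hB⟩ := Finset.exists_subset_card_eq (s := A i) (n := k - σ i) (by omega)
      have := hσ i
      exact ⟨B, hBA, by omega, Or.inr (by omega)⟩
  choose B hBA hBk hB using hB
  rw [h.iInf_colSpan_eq σ A B hBA hB, h'.iInf_colSpan_eq σ A B hBA hB]
  have hQ : ∀ q ∈ Finset.univ.image (fun i => (σ i, B i)), q.1 + q.2.card ≤ k := by
    intro q hq
    obtain ⟨i, _, rfl⟩ := Finset.mem_image.1 hq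
    exact hBk i
  exact (h _ hQ).finrank_iInf_eq (h' _ hQ)

theorem prefixSpan_sup_colSpan {F κ : Type*} [Field F] {k : ℕ} (U : Matrix (Fin k) (Fin k) F)
    (V : Matrix (Fin k) κ F) (s : ℕ) (A : Finset κ) :
    prefixSpan U s ⊔ colSpan V (A : Set κ) =
      colSpan (Matrix.fromCols U V) (prefixUnion k s A : Set (Fin k ⊕ κ)) := by
  rw [prefixSpan, colSpan, colSpan, colSpan, ← Submodule.span_union]
  congr 1
  ext v
  simp only [prefixUnion, Set.mem_union, Set.mem_image, Set.mem_ofPred_eq, SetLike.mem_coe,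
    Sum.exists, Finset.inl_mem_disjSum, Finset.inr_mem_disjSum, Finset.mem_filter,
    Finset.mem_univ, true_and, Matrix.fromCols_apply_inl, Matrix.fromCols_apply_inr]

theorem colSpan_eq_fromCols {F κ : Type*} [Field F] {k : ℕ} (U : Matrix (Fin k) (Fin k) F)
    (V : Matrix (Fin k) κ F) (A : Finset κ) :
    colSpan V (A : Set κ) =
      colSpan (Matrix.fromCols U V) (prefixUnion k 0 A : Set (Fin k ⊕ κ)) := by
  rw [← prefixSpan_sup_colSpan, prefixSpan]
  simp [colSpan]

theorem IsPrefixExtremal.isMDSb {F : Type*} [Field F] {k n : ℕ} {U : Matrix (Fin k) (Fin k) F}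
    {V : Matrix (Fin k) (Fin n) F} (h : IsPrefixExtremal (Matrix.fromCols U V))
    {e : Fin k → ℕ} (he : StrictMono e) (ℓ : ℕ) : IsMDSb ℓ U V := by
  classical
  -- The generic matrix specializes to `[1 | V]` with `V` in independent variables.
  have hW : IsPrefixExtremal (Matrix.fromCols (genericBasis F k k n) (genericCode F k k n)) := by
    let χ : MvPolynomial (Fin k × (Fin k ⊕ Fin n)) F →+* MvPolynomial (Fin n) F :=
      MvPolynomial.eval₂Hom MvPolynomial.C fun x => basisCode e MvPolynomial.X x.1 x.2
    have := isPrefixExtremal_map_of_injective he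
      (Matrix.of fun i j => MvPolynomial.X (i, j)) χ
      (Matrix.ext fun i j => MvPolynomial.eval₂Hom_X' _ _ (i, j))
      (algebraMap _ (GenericField F (Fin k) (Fin k ⊕ Fin n))) (IsFractionRing.injective _ _)
    convert this using 1
    ext i (j | j) <;> rfl
  intro σ A hσ
  obtain ⟨B, rfl⟩ : ∃ B : Fin ℓ → Finset (Fin n), A = fun i => (B i : Set (Fin n)) :=
    ⟨fun i => (A i).toFinset, by simp⟩
  have key := h.finrank_iInf_eq hW σ B hσ
  rw [iInf_congr fun i => (prefixSpan_sup_colSpan U V (σ i) (B i)).symm,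
    iInf_congr fun i => (prefixSpan_sup_colSpan (genericBasis F k k n) (genericCode F k k n) (σ i)
      (B i)).symm] at key
  exact key

theorem IsPrefixExtremal.isMDS {F : Type*} [Field F] {k n : ℕ} {U : Matrix (Fin k) (Fin k) F}
    {V : Matrix (Fin k) (Fin n) F} (h : IsPrefixExtremal (Matrix.fromCols U V))
    {e : Fin k → ℕ} (he : StrictMono e) (ℓ : ℕ) : IsMDS ℓ V := by
  classical
  -- Here the basis is irrelevant, and the identity keeps the entries in the field of the code.
  have hW : IsPrefixExtremal (Matrix.fromCols 1 (genericMatrix F (Fin k) (Fin n))) := by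
    let χ : MvPolynomial (Fin k × Fin n) F →+* MvPolynomial (Fin n) F :=
      MvPolynomial.eval₂Hom MvPolynomial.C fun x => basisCode e MvPolynomial.X x.1 (Sum.inr x.2)
    have := isPrefixExtremal_map_of_injective he
      (Matrix.fromCols 1 (Matrix.of fun i j => MvPolynomial.X (i, j))) χ
      (by
        ext1 i (j | j)
        · exact χ.map_one_matrix_apply i j
        · exact MvPolynomial.eval₂Hom_X' _ _ (i, j))
      (algebraMap _ (GenericField F (Fin k) (Fin n))) (IsFractionRing.injective _ _)
    convert this using 1
    ext i (j | j)
    · exact ((algebraMap (MvPolynomial (Fin k × Fin n) F)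
        (GenericField F (Fin k) (Fin n))).map_one_matrix_apply i j).symm
    · rfl
  intro A
  obtain ⟨B, rfl⟩ : ∃ B : Fin ℓ → Finset (Fin n), A = fun i => (B i : Set (Fin n)) :=
    ⟨fun i => (A i).toFinset, by simp⟩
  have key := h.finrank_iInf_eq hW (fun _ => 0) B (fun _ => Nat.zero_le _)
  rw [iInf_congr fun i => (colSpan_eq_fromCols U V (B i)).symm,
    iInf_congr fun i => (colSpan_eq_fromCols (1 : Matrix (Fin k) (Fin k) _)
      (genericMatrix F (Fin k) (Fin n)) (B i)).symm] at key
  exact key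

theorem colSpan_mul_le {F ι κ : Type*} [Field F] (G : Matrix ι κ F) (c : κ → F) (A : Set κ) :
    colSpan (fun i j => c j * G i j) A ≤ colSpan G A := by
  refine Submodule.span_le.2 ?_
  rintro _ ⟨j, hj, rfl⟩
  exact Submodule.smul_mem _ (c j) (Submodule.subset_span ⟨j, hj, rfl⟩)

/-- Scaling the columns changes the exponents by a constant. -/
theorem colSpan_monomialMatrix {F : Type*} [Field F] {k n : ℕ} {e : Fin k → ℤ} {f : Fin k → ℕ}
    {a : ℤ} (hf : ∀ m, e m = a + f m) {α : Fin n → F} (hα : ∀ j, α j ≠ 0) (A : Set (Fin n)) :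
    colSpan (monomialMatrix e α) A = colSpan (fun m j => α j ^ f m) A := by
  have h1 : monomialMatrix e α = fun m j => α j ^ a * α j ^ f m := by
    ext m j
    rw [monomialMatrix, hf, zpow_add₀ (hα j), zpow_natCast]
  have h2 : (fun m j => α j ^ f m : Matrix (Fin k) (Fin n) F) =
      fun m j => α j ^ (-a) * monomialMatrix e α m j := by
    ext m j
    rw [monomialMatrix, ← zpow_add₀ (hα j), hf, neg_add_cancel_left, zpow_natCast]
  refine le_antisymm ?_ ?_
  · rw [h1]
    exact colSpan_mul_le _ _ A
  · rw [h2]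
    exact colSpan_mul_le _ _ A

/-- The common form of both senses of genericity: away from the zeros of one polynomial over an
arbitrary subfield, the monomial code has the properties of all orders. -/
theorem exists_forall_isMDS_and_isMDSb (K : Type v) [Field K] {k n : ℕ} (e : Fin k → ℤ)
    (he : StrictMono e) :
    ∃ P : MvPolynomial (Fin n) K, P ≠ 0 ∧ ∀ {F : Type u} [Field F] [Algebra K F] (α : Fin n → F),
      MvPolynomial.aeval α P ≠ 0 → ∀ ℓ, IsMDS ℓ (monomialMatrix e α) ∧
        IsMDSb ℓ (1 : Matrix (Fin k) (Fin k) F) (monomialMatrix e α) := by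
  -- After division of the columns by `α j ^ a` the exponents are natural numbers.
  obtain ⟨a, ha⟩ : ∃ a : ℤ, ∀ m, a ≤ e m := by
    obtain ⟨a, ha⟩ := (Set.finite_range e).bddBelow
    exact ⟨a, fun m => ha ⟨m, rfl⟩⟩
  set f : Fin k → ℕ := fun m => (e m - a).toNat with hf
  have hfe : ∀ m, e m = a + f m := fun m => by
    have := ha m
    simp only [hf]
    omega
  have hfm : StrictMono f := fun i j hij => by
    have h1 := he hij
    have h2 := hfe i
    have h3 := hfe j
    omega
  obtain ⟨P, hP, hP'⟩ := exists_forall_isPrefixExtremal_basisCode K (Fin n) hfm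
  refine ⟨P * ∏ j, MvPolynomial.X j, mul_ne_zero hP
    (Finset.prod_ne_zero_iff.2 fun j _ => MvPolynomial.X_ne_zero j), fun {F} _ _ α hα ℓ => ?_⟩
  rw [map_mul, map_prod] at hα
  have hα0 : ∀ j, α j ≠ 0 := fun j => by
    simpa using Finset.prod_ne_zero_iff.1 (right_ne_zero_of_mul hα) j (Finset.mem_univ j)
  have h := hP' (MvPolynomial.aeval α : MvPolynomial (Fin n) K →ₐ[K] F).toRingHom
    (left_ne_zero_of_mul hα)
  have h' : IsPrefixExtremal
      (Matrix.fromCols (1 : Matrix (Fin k) (Fin k) F) (fun m j => α j ^ f m)) := by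
    convert h using 1
    rw [basisCode]
    simp
  have h1 := h'.isMDS hfm ℓ
  have h2 := h'.isMDSb hfm ℓ
  refine ⟨fun A => ?_, fun σ A hσ => ?_⟩
  · rw [iInf_congr fun i => colSpan_monomialMatrix hfe hα0 (A i)]
    exact h1 A
  · rw [iInf_congr fun i => congrArg (prefixSpan 1 (σ i) ⊔ ·)
      (colSpan_monomialMatrix hfe hα0 (A i))]
    exact h2 σ A hσ

theorem mainTheorem3 {F : Type u} [Field F] [IsAlgClosed F] {k n : ℕ}
    (e : Fin k → ℤ) (he : StrictMono e) :
    (∃ P : MvPolynomial (Fin n) F, P ≠ 0 ∧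
      ∀ α : Fin n → F, MvPolynomial.eval α P ≠ 0 →
        (∀ ℓ : ℕ, 2 ≤ ℓ → IsMDS ℓ (monomialMatrix e α)) ∧
        (∀ ℓ : ℕ, 1 ≤ ℓ →
          IsMDSb ℓ (1 : Matrix (Fin k) (Fin k) F) (monomialMatrix e α))) ∧
    (∀ (K : Type v) [Field K] [Algebra K F] (α : Fin n → F), AlgebraicIndependent K α →
        (∀ ℓ : ℕ, 2 ≤ ℓ → IsMDS ℓ (monomialMatrix e α)) ∧
        (∀ ℓ : ℕ, 1 ≤ ℓ →
          IsMDSb ℓ (1 : Matrix (Fin k) (Fin k) F) (monomialMatrix e α))) := by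
  constructor
  · obtain ⟨P, hP, hP'⟩ := exists_forall_isMDS_and_isMDSb F (n := n) e he
    refine ⟨P, hP, fun α hα => ?_⟩
    have h := hP' α (by rwa [MvPolynomial.aeval_eq_eval])
    exact ⟨fun ℓ _ => (h ℓ).1, fun ℓ _ => (h ℓ).2⟩
  · intro K _ _ α hα
    obtain ⟨P, hP, hP'⟩ := exists_forall_isMDS_and_isMDSb K (n := n) e he
    have h := hP' α fun h0 => hP (hα (h0.trans (map_zero _).symm))
    exact ⟨fun ℓ _ => (h ℓ).1, fun ℓ _ => (h ℓ).2⟩
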